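/- Let $d,N\ge 1$, $B>0$ and $0\le\gamma\le \frac1{8d}$. For $H\in\mathbb R^{d\times N}$ put $M(H)=\frac1N HH^\top$ and let $\mathrm{BN}(H)=\mathrm{diag}(M(H))^{-1/2}H$, i.e. every nonzero row of $H$ is rescaled to Euclidean norm $\sqrt N$ (zero rows are left equal to zero). Let $P$ be a probability law on $\mathbb R$ that has a density, is symmetric around $0$, is supported in $[-B,B]$, and has mean $0$ and variance $1$. Let $W_0,W_1,\dots$ be random $d\times d$ matrices all of whose entries are i.i.d. with law $P$. For an input $X\in\mathbb R^{d\times N}$ let $$H_0=X,\qquad H_{\ell+1}=\mathrm{BN}(H_\ell+\gamma W_\ell H_\ell)\quad(\ell\ge 0).$$ Let $E$ be a state space of the Markov chain $(H_\ell)_{\ell\ge1}$, that is, a measurable set of $d\times N$ matrices whose rows all have norm $\sqrt N$, such that $H_1\in E$ almost surely and such that the chain almost surely does not leave $E$: for every $H\in E$, $\mathrm{BN}(H+\gamma WH)\in E$ almost surely, where $W$ has i.i.d. entries of law $P$. Suppose that the chain admits a unique invariant distribution on $E$, that is, exactly one probability measure $\nu$ with $\nu(E)=1$ such that $\mathrm{BN}(H+\gamma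 WH)\sim\nu$ whenever $H\sim\nu$ is independent of $W$. Then the following hold. 1. If $\mathrm{rank}(X)\ge 2$ (for instance, if $X$ has full rank $d\ge2$), then almost surely $\mathrm{rank}(H_\ell)\ge 2$ for all $\ell\ge0$. 2. If $E$ is closed under sign flips of rows ($SH\in E$ for all $H\in E$ and all diagonal $S$ with diagonal entries in $\{+1,-1\}$; for example, $E$ may be the set of all $d\times N$ matrices with rows of norm $\sqrt N$, whenever it is a state space of the chain) and $\gamma\le\frac1{8Bd}$, then, with no assumption on $X$, almost surely $\mathrm{rank}(H_\ell)\ge 2$ for all $\ell\ge0$. -/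

import Mathlib

open MeasureTheory ProbabilityTheory

noncomputable section

/-- Real matrices carry the product σ-algebra of their entries (the Borel σ-algebra). -/
instance Matrix.instMeasurableSpaceReal {m n : Type*} : MeasurableSpace (Matrix m n ℝ) :=
  inferInstanceAs (MeasurableSpace (m → n → ℝ))

namespace BatchNorm

/-- The second moment matrix `M(H) = H Hᵀ / N` of a `d × N` matrix of hidden representations. -/
def secondMoment {d N : ℕ} (H : Matrix (Fin d) (Fin N) ℝ) : Matrix (Fin d) (Fin d) ℝ :=
  (N : ℝ)⁻¹ • (H * H.transpose)

/-- The batch normalization operator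
`BN_{α,β}(H) = β ∘ diag(M(H))^{-1/2} H + α 1ᵀ`, where `∘` is the row-wise product.
A zero row of `H`, which cannot be normalized, is sent to the constant row `α i`. -/
def batchNorm {d N : ℕ} (α β : Fin d → ℝ) (H : Matrix (Fin d) (Fin N) ℝ) :
    Matrix (Fin d) (Fin N) ℝ :=
  Matrix.of fun i j => β i * ((√(secondMoment H i i))⁻¹ * H i j) + α i

/-- One residual layer with batch normalization: `BN_{0,1}(H + γ W H)`. -/
def layer {d N : ℕ} (γ : ℝ) (W : Matrix (Fin d) (Fin d) ℝ) (H : Matrix (Fin d) (Fin N) ℝ) :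
    Matrix (Fin d) (Fin N) ℝ :=
  batchNorm 0 1 (H + γ • (W * H))

/-- The hidden representations `H_ℓ` of the input `X` in a network with weights `W_0, W_1, …`. -/
def hidden {d N : ℕ} (γ : ℝ) (X : Matrix (Fin d) (Fin N) ℝ)
    (W : ℕ → Matrix (Fin d) (Fin d) ℝ) : ℕ → Matrix (Fin d) (Fin N) ℝ
  | 0 => X
  | ℓ + 1 => layer γ (W ℓ) (hidden γ X W ℓ)

/-- The normalized matrices: all rows have Euclidean norm `√N`. -/
def normalized (d N : ℕ) : Set (Matrix (Fin d) (Fin N) ℝ) :=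
  {H | ∀ i, √(∑ j, H i j ^ 2) = √(N : ℝ)}

/-- A set of states that contains with `H` every `S H`, where `S` is diagonal with diagonal
entries in `{+1, -1}`. -/
def SignFlipClosed {d N : ℕ} (E : Set (Matrix (Fin d) (Fin N) ℝ)) : Prop :=
  ∀ s : Fin d → ℝ, (∀ i, s i = 1 ∨ s i = -1) → ∀ H ∈ E, Matrix.diagonal s * H ∈ E

/-- The law of a `d × d` weight matrix with i.i.d. entries of law `P`. -/
def weightLaw (d : ℕ) (P : Measure ℝ) : Measure (Matrix (Fin d) (Fin d) ℝ) :=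
  (Measure.pi fun _ : Fin d => Measure.pi fun _ : Fin d => P).map Matrix.of

/-- The transition kernel of the Markov chain of hidden representations:
from `H`, move to `BN_{0,1}(H + γ W H)` with `W` a fresh random weight matrix. -/
def bnKernel (d N : ℕ) (γ : ℝ) (P : Measure ℝ) :
    Kernel (Matrix (Fin d) (Fin N) ℝ) (Matrix (Fin d) (Fin N) ℝ) :=
  (Kernel.const _ (weightLaw d P) ×ₖ Kernel.id).map fun p => layer γ p.1 p.2

/-- The chain with transition kernel `κ`, run on the set of states `E`, admits exactly one
invariant probability distribution. -/
def HasUniqueInvariantLaw {S : Type*} [MeasurableSpace S] (κ : Kernel S S) (E : Set S) : Prop :=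
  ∃! ν : Measure S, IsProbabilityMeasure ν ∧ ν E = 1 ∧ κ.Invariant ν

theorem measurable_entry {m n : Type*} (i : m) (j : n) :
    Measurable fun A : Matrix m n ℝ => A i j :=
  (measurable_pi_apply j).comp (measurable_pi_apply (X := fun _ : m => n → ℝ) i)

theorem measurable_of_entries {Ω m n : Type*} [MeasurableSpace Ω] {f : Ω → Matrix m n ℝ}
    (hf : ∀ i j, Measurable fun ω => f ω i j) : Measurable f :=
  measurable_pi_lambda (X := fun _ : m => n → ℝ) f
    fun i => measurable_pi_lambda _ fun j => hf i j

theorem measurable_layer {d N : ℕ} (γ : ℝ) :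
    Measurable fun p : Matrix (Fin d) (Fin d) ℝ × Matrix (Fin d) (Fin N) ℝ =>
      layer γ p.1 p.2 := by
  have hG : ∀ i j, Measurable fun p : Matrix (Fin d) (Fin d) ℝ × Matrix (Fin d) (Fin N) ℝ =>
      (p.2 + γ • (p.1 * p.2)) i j := by
    intro i j
    simp only [Matrix.add_apply, Matrix.smul_apply, Matrix.mul_apply, smul_eq_mul]
    refine ((measurable_entry i j).comp measurable_snd).add (Measurable.const_mul ?_ γ)
    exact Finset.measurable_sum _ fun k _ =>
      ((measurable_entry i k).comp measurable_fst).mul ((measurable_entry k j).comp measurable_snd)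
  refine measurable_of_entries fun i j => ?_
  simp only [layer, batchNorm, secondMoment, Matrix.of_apply, Matrix.smul_apply, Matrix.mul_apply,
    Matrix.transpose_apply, smul_eq_mul]
  refine Measurable.add_const (Measurable.const_mul (Measurable.mul ?_ (hG i j)) _) _
  refine (Real.continuous_sqrt.measurable.comp (Measurable.const_mul ?_ _)).inv
  exact Finset.measurable_sum _ fun k _ => (hG i k).mul (hG i k)

instance {d : ℕ} {P : Measure ℝ} [IsProbabilityMeasure P] :
    IsProbabilityMeasure (weightLaw d P) :=
  Measure.isProbabilityMeasure_map (measurable_id (α := Fin d → Fin d → ℝ)).aemeasurable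

/-- The kernel at `H` is the law of `BN_{0,1}(H + γ W H)`. -/
theorem bnKernel_apply {d N : ℕ} (γ : ℝ) (P : Measure ℝ) [IsProbabilityMeasure P]
    (H : Matrix (Fin d) (Fin N) ℝ) :
    bnKernel d N γ P H = (weightLaw d P).map fun W => layer γ W H := by
  rw [bnKernel, Kernel.map_apply _ (measurable_layer γ), Kernel.prod_apply, Kernel.const_apply,
    Kernel.id_apply, Measure.prod_dirac, Measure.map_map (measurable_layer γ) (by fun_prop)]
  rfl

end BatchNorm

end

/-! A layer maps `H` to `D (1 + γ W) H` with `D` diagonal and invertible. The determinant of `1 + γ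
W` is a polynomial in the entries of `W` with value `1` at `W = 0`, so under atomless independent
entries it is almost surely nonzero. Hence almost surely the rank stays equal to that of `X`, which
gives the first claim.

For the second claim, a normalized matrix of rank at most one has rows equal up to sign. Small
weights only multiply each row by a positive factor, which normalization removes, so such an `H` is
a fixed point and its Dirac mass is invariant (`layer_eq_self_of_rank_le_one`, `invariant_dirac`).
If `H` lies in a sign-closed `E`, so does `-H`, and two invariant laws contradict uniqueness. Thus
`E` contains only matrices of rank at least two. Since `H_1 ∈ E` and its rank is at most that of
`X`, the first claim applies. -/

open MeasureTheory ProbabilityTheory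

/-! ### Zero sets of polynomials in independent atomless variables -/

namespace MvPolynomial

/-- The zero set of a nonzero polynomial is null for a product of atomless measures. -/
theorem ae_pi_eval_ne_zero {n : ℕ} (P : Fin n → Measure ℝ) [∀ i, IsProbabilityMeasure (P i)]
    [∀ i, NullSingletonClass (P i)] (p : MvPolynomial (Fin n) ℝ) (hp : p ≠ 0) :
    ∀ᵐ x ∂Measure.pi P, eval x p ≠ 0 := by
  induction n with
  | zero =>
    refine Filter.Eventually.of_forall fun x hx => hp (funext fun y => ?_)
    rw [Subsingleton.elim y x, hx, map_zero]
  | succ n ih =>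
    -- Fubini: `q` is `p` as a polynomial in the first variable. For almost every value of the
    -- others its leading coefficient is nonzero, which leaves finitely many roots, a null set.
    set q := finSuccEquiv ℝ n p with hq
    have hq0 : q ≠ 0 := by simpa [hq] using hp
    have hmp := (measurePreserving_piFinSuccAbove P 0).symm
    have hmeas : MeasurableSet {x : Fin (n + 1) → ℝ | eval x p ≠ 0} :=
      ((MvPolynomial.continuous_eval p).measurable (measurableSet_singleton 0)).compl
    rw [← hmp.map_eq, ae_map_iff hmp.measurable.aemeasurable hmeas]
    have hswap : ∀ᵐ z ∂(Measure.pi fun j => P (Fin.succAbove 0 j)).prod (P 0),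
        eval (Fin.cons z.2 z.1 : Fin (n + 1) → ℝ) p ≠ 0 := by
      have hm : MeasurableSet {z : (Fin n → ℝ) × ℝ |
          eval (Fin.cons z.2 z.1 : Fin (n + 1) → ℝ) p ≠ 0} := by
        refine (((MvPolynomial.continuous_eval p).comp ?_).measurable
          (measurableSet_singleton 0)).compl
        fun_prop
      rw [Measure.ae_prod_iff_ae_ae hm]
      filter_upwards [ih (fun j => P (Fin.succAbove 0 j)) q.leadingCoeff (by simpa using hq0)]
        with s hs
      have hr : q.map (eval s) ≠ 0 := fun h => hs <| by
        simpa [Polynomial.coeff_map] using congrArg (fun r => Polynomial.coeff r q.natDegree) h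
      have hfin : {y | (q.map (eval s)).IsRoot y}.Finite := Polynomial.finite_setOfPred_isRoot hr
      filter_upwards [measure_eq_zero_iff_ae_notMem.1 (hfin.measure_zero (P 0))] with y hy
      rw [eval_eq_eval_mv_eval']
      exact hy
    have := Measure.measurePreserving_swap (μ := P 0)
      (ν := Measure.pi fun j => P (Fin.succAbove 0 j)) |>.quasiMeasurePreserving.ae hswap
    filter_upwards [this] with z hz
    simpa [MeasurableEquiv.piFinSuccAbove, Fin.insertNth_zero', Fin.consEquiv] using hz

/-- A nonzero polynomial in independent random variables with atomless laws is almost surely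
nonzero. -/
theorem ae_eval_ne_zero_of_iIndepFun {Ω σ : Type*} [MeasurableSpace Ω] [Fintype σ]
    {μ : Measure Ω} [IsProbabilityMeasure μ] {Y : σ → Ω → ℝ} (hY : ∀ i, Measurable (Y i))
    (hindep : iIndepFun Y μ) (hatom : ∀ i, NullSingletonClass (μ.map (Y i)))
    (p : MvPolynomial σ ℝ) (hp : p ≠ 0) : ∀ᵐ ω ∂μ, eval (fun i => Y i ω) p ≠ 0 := by
  let e := Fintype.equivFin σ
  have hmap := (iIndepFun_iff_map_fun_eq_pi_map (fun k => (hY (e.symm k)).aemeasurable)).1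
    (hindep.precomp e.symm.injective)
  have : ∀ k, IsProbabilityMeasure (μ.map (Y (e.symm k))) := fun k =>
    Measure.isProbabilityMeasure_map (hY _).aemeasurable
  have hne : rename e p ≠ 0 := fun h => hp (rename_injective e e.injective (by simpa using h))
  have hae := ae_pi_eval_ne_zero (fun k => μ.map (Y (e.symm k))) (rename e p) hne
  have hm : Measurable fun ω k => Y (e.symm k) ω := measurable_pi_lambda _ fun k => hY _
  rw [← hmap] at hae
  filter_upwards [ae_of_ae_map hm.aemeasurable hae] with ω hω
  simpa [eval_rename, Function.comp_def] using hω

end MvPolynomial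

/-- If the entries of `A` are independent with atomless laws, then `1 + c A` is almost surely
invertible. -/
theorem Matrix.ae_det_one_add_smul_ne_zero {Ω n : Type*} [MeasurableSpace Ω] [Fintype n]
    [DecidableEq n] {μ : Measure Ω} [IsProbabilityMeasure μ] {A : Ω → Matrix n n ℝ}
    (hA : ∀ i j, Measurable fun ω => A ω i j)
    (hindep : iIndepFun (fun (k : n × n) ω => A ω k.1 k.2) μ)
    (hatom : ∀ i j, NullSingletonClass (μ.map fun ω => A ω i j)) (c : ℝ) :
    ∀ᵐ ω ∂μ, (1 + c • A ω).det ≠ 0 := by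
  let M : Matrix n n (MvPolynomial (n × n) ℝ) := 1 + (MvPolynomial.C c : MvPolynomial (n × n) ℝ) • mvPolynomialX n n ℝ
  have heval (B : Matrix n n ℝ) :
      MvPolynomial.eval (fun k : n × n => B k.1 k.2) M.det = (1 + c • B).det := by
    rw [RingHom.map_det]
    congr 1
    ext i j
    simp [M, Matrix.one_apply, apply_ite]
  -- At the zero matrix the determinant is `1`.
  have hM : M.det ≠ 0 := fun h => by
    have := heval 0
    simp [h] at this
  filter_upwards [MvPolynomial.ae_eval_ne_zero_of_iIndepFun (fun k => hA k.1 k.2) hindep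
    (fun k => hatom k.1 k.2) M.det hM] with ω hω
  rwa [heval] at hω

/-! ### Rank along the layers -/

namespace BatchNorm

variable {d N : ℕ}

theorem secondMoment_diag (H : Matrix (Fin d) (Fin N) ℝ) (i : Fin d) :
    secondMoment H i i = (N : ℝ)⁻¹ * ∑ j, H i j ^ 2 := by
  simp [secondMoment, Matrix.mul_apply, sq]

theorem row_eq_zero_of_secondMoment_eq_zero (hN : 0 < N) {H : Matrix (Fin d) (Fin N) ℝ}
    {i : Fin d} (h : √(secondMoment H i i) = 0) (j : Fin N) : H i j = 0 := by
  have hN' : (0 : ℝ) < N := by exact_mod_cast hN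
  have hs : 0 ≤ ∑ j, H i j ^ 2 := Finset.sum_nonneg fun j _ => sq_nonneg _
  rw [secondMoment_diag, Real.sqrt_eq_zero (by positivity), mul_eq_zero,
    or_iff_right (by positivity), Finset.sum_eq_zero_iff_of_nonneg fun j _ => sq_nonneg _] at h
  simpa using h j (Finset.mem_univ j)

/-- Batch normalization without affine parameters rescales the rows by nonzero factors. -/
theorem batchNorm_eq_diagonal_mul (hN : 0 < N) (H : Matrix (Fin d) (Fin N) ℝ) :
    ∃ D : Fin d → ℝ, (∀ i, D i ≠ 0) ∧ batchNorm 0 1 H = Matrix.diagonal D * H := by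
  -- A zero row would get the factor `0⁻¹ = 0`; any factor fixes it, and `1` keeps `D` invertible.
  refine ⟨fun i => if √(secondMoment H i i) = 0 then 1 else (√(secondMoment H i i))⁻¹,
    fun i => ?_, ?_⟩
  · dsimp only
    split_ifs with h
    · exact one_ne_zero
    · exact inv_ne_zero h
  · ext i j
    rw [Matrix.diagonal_mul]
    split_ifs with h
    · simp [batchNorm, row_eq_zero_of_secondMoment_eq_zero hN h j]
    · simp [batchNorm]

theorem rank_batchNorm (hN : 0 < N) (H : Matrix (Fin d) (Fin N) ℝ) :
    (batchNorm 0 1 H).rank = H.rank := by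
  obtain ⟨D, hD, h⟩ := batchNorm_eq_diagonal_mul hN H
  rw [h, Matrix.rank_mul_eq_right_of_det_ne_zero]
  simpa [Matrix.det_diagonal, Finset.prod_ne_zero_iff] using hD

/-- Holds for every `W`, invertible or not; it carries a rank bound on `H_1` back to `X`. -/
theorem rank_layer_le (hN : 0 < N) (γ : ℝ) (W : Matrix (Fin d) (Fin d) ℝ)
    (H : Matrix (Fin d) (Fin N) ℝ) : (layer γ W H).rank ≤ H.rank := by
  have : H + γ • (W * H) = (1 + γ • W) * H := by simp [Matrix.add_mul]
  rw [layer, rank_batchNorm hN, this]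
  exact Matrix.rank_mul_le_right _ _

theorem rank_layer (hN : 0 < N) {γ : ℝ} {W : Matrix (Fin d) (Fin d) ℝ}
    (hW : (1 + γ • W).det ≠ 0) (H : Matrix (Fin d) (Fin N) ℝ) :
    (layer γ W H).rank = H.rank := by
  have : H + γ • (W * H) = (1 + γ • W) * H := by simp [Matrix.add_mul]
  rw [layer, rank_batchNorm hN, this, Matrix.rank_mul_eq_right_of_det_ne_zero _ _ hW]

theorem rank_hidden (hN : 0 < N) {γ : ℝ} {W : ℕ → Matrix (Fin d) (Fin d) ℝ}
    (hW : ∀ ℓ, (1 + γ • W ℓ).det ≠ 0) (X : Matrix (Fin d) (Fin N) ℝ) (ℓ : ℕ) :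
    (hidden γ X W ℓ).rank = X.rank := by
  induction ℓ with
  | zero => rfl
  | succ ℓ ih => rw [hidden, rank_layer hN (hW ℓ), ih]

/-! ### Rank-one states as fixed points, and uniqueness of the invariant law -/

theorem sum_sq_of_mem_normalized {H : Matrix (Fin d) (Fin N) ℝ} (hH : H ∈ normalized d N)
    (i : Fin d) : ∑ j, H i j ^ 2 = N :=
  (Real.sqrt_inj (Finset.sum_nonneg fun _ _ => sq_nonneg _) (Nat.cast_nonneg N)).1 (hH i)

/-- A normalized matrix of rank at most one has rows that are equal up to sign. -/
theorem exists_sign_of_rank_le_one (hN : 0 < N) {H : Matrix (Fin d) (Fin N) ℝ}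
    (hH : H ∈ normalized d N) (hrank : H.rank ≤ 1) (i₀ : Fin d) :
    ∃ c : Fin d → ℝ, (∀ i, c i = 1 ∨ c i = -1) ∧ ∀ i j, H i j = c i * H i₀ j := by
  have hN' : (0 : ℝ) < N := by exact_mod_cast hN
  rw [Matrix.rank_eq_finrank_span_row, finrank_le_one_iff] at hrank
  obtain ⟨v, hv⟩ := hrank
  have hrow : ∀ i, ∃ a : ℝ, ∀ j, H i j = a * (v : Fin N → ℝ) j := fun i => by
    obtain ⟨a, ha⟩ := hv ⟨H.row i, Submodule.subset_span (Set.mem_range_self i)⟩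
    exact ⟨a, fun j => by simpa using (congrFun (congrArg Subtype.val ha) j).symm⟩
  choose a ha using hrow
  have hsum (i : Fin d) : a i ^ 2 * ∑ j, (v : Fin N → ℝ) j ^ 2 = N := by
    rw [← sum_sq_of_mem_normalized hH i, Finset.mul_sum]
    exact Finset.sum_congr rfl fun j _ => by rw [ha, mul_pow]
  have ha₀ : a i₀ ≠ 0 := fun h => by
    have := hsum i₀
    rw [h, zero_pow two_ne_zero, zero_mul] at this
    exact hN'.ne this
  refine ⟨fun i => a i / a i₀, fun i => ?_, fun i j => ?_⟩
  · have hv0 : ∑ j, (v : Fin N → ℝ) j ^ 2 ≠ 0 := fun h => by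
      have := hsum i₀
      rw [h, mul_zero] at this
      exact hN'.ne this
    have hsq : a i ^ 2 = a i₀ ^ 2 := mul_right_cancel₀ hv0 ((hsum i).trans (hsum i₀).symm)
    rcases sq_eq_sq_iff_eq_or_eq_neg.1 hsq with h | h
    · exact Or.inl (by simp only [h, div_self ha₀])
    · exact Or.inr (by simp only [h, neg_div, div_self ha₀])
  · rw [ha, ha]
    field_simp

/-- Normalized matrices of rank at most one are not moved by layers with small weights. -/
theorem layer_eq_self_of_rank_le_one (hN : 0 < N) {γ B : ℝ} (hγ : 0 ≤ γ) (hγB : γ * (d * B) < 1)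
    {H : Matrix (Fin d) (Fin N) ℝ} (hH : H ∈ normalized d N) (hrank : H.rank ≤ 1)
    {W : Matrix (Fin d) (Fin d) ℝ} (hW : ∀ i j, W i j ∈ Set.Icc (-B) B) :
    layer γ W H = H := by
  have hN' : (N : ℝ) ≠ 0 := by exact_mod_cast hN.ne'
  ext i j
  -- The reference row is row `i` itself, so row `i` of `H + γ W H` is `t` times row `i` of `H`.
  obtain ⟨c, hc, hHc⟩ := exists_sign_of_rank_le_one hN hH hrank i
  set t : ℝ := 1 + γ * ∑ k, W i k * c k with ht_def
  have ht : 0 < t := by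
    have hsum : -(d * B) ≤ ∑ k, W i k * c k := by
      calc -(d * B) = ∑ _k : Fin d, -B := by simp
        _ ≤ _ := Finset.sum_le_sum fun k _ => by
          have := hW i k
          rcases hc k with h | h <;> rw [h] <;> linarith [this.1, this.2]
    nlinarith [mul_le_mul_of_nonneg_left hsum hγ]
  have hrow (l : Fin N) : (H + γ • (W * H)) i l = t * H i l := by
    have : (W * H) i l = (∑ k, W i k * c k) * H i l := by
      rw [Matrix.mul_apply, Finset.sum_mul]
      exact Finset.sum_congr rfl fun k _ => by rw [hHc k l, mul_assoc]
    rw [Matrix.add_apply, Matrix.smul_apply, this, smul_eq_mul, ht_def]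
    ring
  have hsm : √(secondMoment (H + γ • (W * H)) i i) = t := by
    rw [secondMoment_diag]
    simp_rw [hrow, mul_pow]
    rw [← Finset.mul_sum, sum_sq_of_mem_normalized hH, mul_comm (t ^ 2), inv_mul_cancel_left₀ hN',
      Real.sqrt_sq ht.le]
  simp only [layer, batchNorm, Matrix.of_apply, hsm, hrow, Pi.one_apply, Pi.zero_apply, one_mul,
    add_zero]
  rw [inv_mul_cancel_left₀ ht.ne']

/-- The entries of a random weight matrix lie in any set that carries `P`. -/
theorem ae_weightLaw_entry {P : Measure ℝ} [IsProbabilityMeasure P] {p : ℝ → Prop}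
    (hp : ∀ᵐ x ∂P, p x) : ∀ᵐ W ∂weightLaw d P, ∀ i j, W i j ∈ {x | p x} := by
  have hid : Measurable (Matrix.of : (Fin d → Fin d → ℝ) → Matrix (Fin d) (Fin d) ℝ) :=
    measurable_id (α := Fin d → Fin d → ℝ)
  refine ae_all_iff.2 fun i => ae_all_iff.2 fun j => ?_
  have hmp : (weightLaw d P).map (fun W => W i j) = P := by
    rw [weightLaw, Measure.map_map (measurable_entry i j) hid]
    exact ((measurePreserving_eval (fun _ : Fin d => P) j).comp
      (measurePreserving_eval (fun _ : Fin d => Measure.pi fun _ : Fin d => P) i)).map_eq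
  exact ae_of_ae_map (measurable_entry i j).aemeasurable (by rwa [hmp])

/-- The Dirac mass at a state that is almost surely not moved is invariant. -/
theorem invariant_dirac {P : Measure ℝ} [IsProbabilityMeasure P] {γ : ℝ}
    {H : Matrix (Fin d) (Fin N) ℝ} (h : ∀ᵐ W ∂weightLaw d P, layer γ W H = H) :
    (bnKernel d N γ P).Invariant (Measure.dirac H) := by
  rw [Kernel.Invariant, Measure.dirac_bind (Kernel.measurable _), bnKernel_apply,
    Measure.map_congr (g := fun _ => H) h, Measure.map_const, measure_univ, one_smul]

/-- If the chain on a sign-closed set has a unique invariant law and the weights are small, then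
all states have rank at least two. -/
theorem two_le_rank_of_hasUniqueInvariantLaw (hd : 0 < d) (hN : 0 < N) {γ B : ℝ} (hγ : 0 ≤ γ)
    (hγB : γ * (d * B) < 1) {P : Measure ℝ} [IsProbabilityMeasure P]
    (hP : ∀ᵐ x ∂P, x ∈ Set.Icc (-B) B) {E : Set (Matrix (Fin d) (Fin N) ℝ)}
    (hE : E ⊆ normalized d N) (hflip : SignFlipClosed E)
    (hunique : HasUniqueInvariantLaw (bnKernel d N γ P) E)
    {H : Matrix (Fin d) (Fin N) ℝ} (hH : H ∈ E) : 2 ≤ H.rank := by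
  by_contra hlt
  have key : ∀ G ∈ E, G.rank ≤ 1 → IsProbabilityMeasure (Measure.dirac G) ∧
      Measure.dirac G E = 1 ∧ (bnKernel d N γ P).Invariant (Measure.dirac G) := fun G hG hr => by
    refine ⟨inferInstance, Measure.dirac_apply_of_mem hG, invariant_dirac ?_⟩
    filter_upwards [ae_weightLaw_entry hP] with W hW
    exact layer_eq_self_of_rank_le_one hN hγ hγB (hE hG) hr hW
  set G := Matrix.diagonal (fun _ : Fin d => (-1 : ℝ)) * H with hG
  have hGr : G.rank ≤ 1 := (Matrix.rank_mul_le_right _ _).trans (by omega)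
  have heq := hunique.unique (key H hH (by omega))
    (key G (hflip _ (fun _ => Or.inr rfl) H hH) hGr)
  let i : Fin d := ⟨0, hd⟩
  -- Here `G = -H`. Equal Dirac masses agree on the measurable set `{A | A i j = H i j}`, which
  -- forces `-H i j = H i j`; row `i` then vanishes, against its norm `√N > 0`.
  have hzero : ∀ j, H i j = 0 := fun j => by
    have hm : MeasurableSet {A : Matrix (Fin d) (Fin N) ℝ | A i j = H i j} :=
      measurable_entry i j (measurableSet_singleton _)
    have hmem : H ∈ {A : Matrix (Fin d) (Fin N) ℝ | A i j = H i j} := rfl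
    by_contra hne
    have hnot : G ∉ {A : Matrix (Fin d) (Fin N) ℝ | A i j = H i j} := fun h => by
      rw [Set.mem_ofPred_eq, hG, Matrix.diagonal_mul] at h
      exact hne (by linarith)
    have h := Measure.dirac_apply_of_mem hmem
    rw [heq, Measure.dirac_apply' _ hm, Set.indicator_of_notMem hnot] at h
    exact zero_ne_one h
  have := sum_sq_of_mem_normalized (hE hH) i
  simp only [hzero, ne_eq, OfNat.ofNat_ne_zero, not_false_eq_true, zero_pow,
    Finset.sum_const_zero] at this
  exact hN.ne (by exact_mod_cast this)

end BatchNorm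

theorem mainTheorem5 {d N : ℕ} (hd : 0 < d) (hN : 0 < N)
    (γ B : ℝ) (hγ_nonneg : 0 ≤ γ) (hγ : γ ≤ 1 / (8 * d))
    -- the law of the weights: density, symmetry, bounded support, zero mean, unit variance
    (P : Measure ℝ) [IsProbabilityMeasure P] (hP_density : P ≪ volume)
    (hP_symm : P.map (fun x => -x) = P) (hP_supp : ∀ᵐ x ∂P, x ∈ Set.Icc (-B) B)
    (hP_mean : ∫ x, x ∂P = 0) (hP_var : variance id P = 1)
    -- the random weight matrices, with i.i.d. entries of law `P`
    {Ω : Type*} [MeasurableSpace Ω] (μ : Measure Ω) [IsProbabilityMeasure μ]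
    (W : ℕ → Ω → Matrix (Fin d) (Fin d) ℝ)
    (hW_meas : ∀ ℓ i j, Measurable fun ω => W ℓ ω i j)
    (hW_indep : iIndepFun (fun (k : ℕ × Fin d × Fin d) ω => W k.1 ω k.2.1 k.2.2) μ)
    (hW_law : ∀ ℓ i j, μ.map (fun ω => W ℓ ω i j) = P)
    -- the input
    (X : Matrix (Fin d) (Fin N) ℝ)
    -- the state space of the chain `(H_ℓ)` for `ℓ ≥ 1`, and its unique invariant distribution
    (E : Set (Matrix (Fin d) (Fin N) ℝ)) (hE_meas : MeasurableSet E)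
    (hE_norm : E ⊆ BatchNorm.normalized d N)
    (hE_closed : ∀ H ∈ E, BatchNorm.bnKernel d N γ P H E = 1)
    (hE_start : ∀ᵐ ω ∂μ, BatchNorm.hidden γ X (fun k => W k ω) 1 ∈ E)
    (hE_unique : BatchNorm.HasUniqueInvariantLaw (BatchNorm.bnKernel d N γ P) E) :
    -- an input that is not of rank one or zero, for instance one of full rank `d ≥ 2`
    (2 ≤ X.rank →
      ∀ᵐ ω ∂μ, ∀ ℓ : ℕ, 2 ≤ (BatchNorm.hidden γ X (fun k => W k ω) ℓ).rank) ∧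
    -- an arbitrary input, with a state space that is closed under sign flips of the rows
    (BatchNorm.SignFlipClosed E → γ ≤ 1 / (8 * B * d) →
      ∀ᵐ ω ∂μ, ∀ ℓ : ℕ, 2 ≤ (BatchNorm.hidden γ X (fun k => W k ω) ℓ).rank) := by
  have hatom : NullSingletonClass P := ⟨fun x => hP_density (measure_singleton x)⟩
  have hdet : ∀ᵐ ω ∂μ, ∀ ℓ, (1 + γ • W ℓ ω).det ≠ 0 := by
    refine ae_all_iff.2 fun ℓ => Matrix.ae_det_one_add_smul_ne_zero (hW_meas ℓ)
      (hW_indep.precomp (g := fun k : Fin d × Fin d => (ℓ, k)) (Prod.mk_right_injective ℓ))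
      (fun i j => ?_) γ
    rw [hW_law]
    exact hatom
  have hmain : 2 ≤ X.rank →
      ∀ᵐ ω ∂μ, ∀ ℓ : ℕ, 2 ≤ (BatchNorm.hidden γ X (fun k => W k ω) ℓ).rank := fun hX => by
    filter_upwards [hdet] with ω hω ℓ
    rwa [BatchNorm.rank_hidden hN hω]
  refine ⟨hmain, fun hflip hγB => hmain ?_⟩
  have hd' : (0 : ℝ) < d := by exact_mod_cast hd
  have hsmall : γ * (d * B) < 1 := by
    -- For `B > 0` the bound on `γ` gives `γ d B ≤ 1/8`; for `B ≤ 0` the product is nonpositive.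
    rcases le_or_gt B 0 with hB | hB
    · have : γ * (d * B) ≤ 0 :=
        mul_nonpos_of_nonneg_of_nonpos hγ_nonneg (mul_nonpos_of_nonneg_of_nonpos hd'.le hB)
      linarith
    · rw [le_div_iff₀ (by positivity)] at hγB
      linarith
  -- `X` is deterministic, so a single `ω` with `H_1 ∈ E` bounds its rank.
  obtain ⟨ω, hω⟩ := hE_start.exists
  exact (BatchNorm.two_le_rank_of_hasUniqueInvariantLaw hd hN hγ_nonneg hsmall hP_supp hE_norm
    hflip hE_unique hω).trans (BatchNorm.rank_layer_le hN γ (W 0 ω) X)
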